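/- Definitions. Let $K$ denote prefix-free Kolmogorov complexity of finite binary strings (the length of a shortest program with respect to a fixed universal prefix-free machine), where the two symbols are written $1$ and $-1$. A sequence $\alpha=\alpha_0\alpha_1\alpha_2\dots\in\{-1,1\}^{\mathbb N}$ is *Kolmogorov–Chaitin complex* if there is a constant $k$ such that $K(\alpha_0\cdots\alpha_{n-1})\ge n-k$ for all $n$. An *algorithmically random Rademacher sequence* is a sequence $(\varepsilon_n)_{n\ge 0}$ with $\varepsilon_n=\alpha_n$ for all $n$, for some Kolmogorov–Chaitin complex $\alpha$. A real number $x$ is *computable* if there is a computable sequence of rationals $(r_k)$ with $|r_k-x|\le 2^{-k}$ for all $k$; a sequence $(x_n)_{n\ge 0}$ of reals is *computable* if there is a computable double sequence of rationals $(r_{n,k})$ with $|r_{n,k}-x_n|\le 2^{-k}$ for all $n,k$. A computable sequence $(x_n)_{n\ge0}$ of reals is *square computable* if $\sum_k x_k^2<\infty$ and there is a computable function $N:\mathbb N\to\mathbb N$ such that for every integer $m\ge 1$ $$\Bigl|\sum_{k=0}^{\infty}x_k^2-\sum_{k<N(m)}x_k^2\Bigr|<\frac1m .$$ Theorem (contraction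 principle). Let $(u_n)_{n\ge0}$ be a square computable sequence of real numbers, and let $(\lambda_n)_{n\ge0}$ be a bounded computable sequence of real numbers such that $\sup_n|\lambda_n|$ is a computable real number. Then for every algorithmically random Rademacher sequence $(\varepsilon_n)_{n\ge0}$ the series $\sum_{n=0}^{\infty}\varepsilon_n\lambda_nu_n$ converges in $\mathbb R$, i.e. its partial sums $\sum_{n<N}\varepsilon_n\lambda_nu_n$ tend to a real limit as $N\to\infty$. -/

import Mathlib

open Filter Topology

namespace AlgRandom

/-! ## Prefix-free Kolmogorov complexity -/

/-- A prefix-free machine: a partial recursive function on finite binary strings, no two distinct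
elements of whose domain are comparable for the prefix order. -/
structure IsPrefixFreeMachine (M : List Bool →. List Bool) : Prop where
  partrec : Partrec M
  prefixFree : ∀ p q : List Bool, (M p).Dom → (M q).Dom → p <+: q → p = q

/-- The complexity of `x` relative to `M`: the least length of a program `p` with `M p = x`
(`⊤` if there is none). -/
noncomputable def complexityOf (M : List Bool →. List Bool) (x : List Bool) : ℕ∞ :=
  ⨅ p : List Bool, ⨅ _ : x ∈ M p, (p.length : ℕ∞)

/-- `U` is an optimal (universal) prefix-free machine. -/
structure IsOptimalMachine (U : List Bool →. List Bool) : Prop where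
  isPrefixFree : IsPrefixFreeMachine U
  optimal : ∀ M : List Bool →. List Bool, IsPrefixFreeMachine M →
    ∃ c : ℕ, ∀ x : List Bool, complexityOf U x ≤ complexityOf M x + c

/-! ### The reference machine

A program has the form `1ᵉ 0 q`.  The reference machine reads the bits of `q` one at a time.
After each of them it runs the `e`-th partial recursive function on the part of `q` read so far:
the answer `0` means "read another bit", and an answer `n + 1` means "halt, and output the string
with code `n`".  The program is accepted if its end has just been reached at the time of halting. -/

/-- The number of leading `1`s of a program. -/
def machineIndex (w : List Bool) : ℕ := w.findIdx (fun b => !b)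

/-- What remains of a program after the first block `1ᵉ 0`. -/
def programBody (w : List Bool) : List Bool := w.drop (machineIndex w + 1)

/-- The answer of the machine addressed by `w` when it has read `i` bits of the body. -/
def answer (w : List Bool) (i : ℕ) : Part ℕ :=
  Nat.Partrec.Code.eval (Denumerable.ofNat Nat.Partrec.Code (machineIndex w))
    (Encodable.encode ((programBody w).take i))

/-- Succeeds if the answers after `0, 1, …, i - 1` bits are all "read another bit". -/
def keepsReading (w : List Bool) (i : ℕ) : Part Unit :=
  Nat.rec (Part.some ())
    (fun j ih => ih.bind fun _ => (answer w j).bind fun y =>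
      ((Nat.casesOn y (some ()) fun _ => none : Option Unit) : Part Unit)) i

/-- The reference universal prefix-free machine. -/
def universalMachine (w : List Bool) : Part (List Bool) :=
  ((w.drop (machineIndex w)).head? : Part Bool).bind fun _ =>
    (keepsReading w (programBody w).length).bind fun _ =>
      (answer w (programBody w).length).bind fun y =>
        ((Nat.casesOn y none fun n => Encodable.decode n : Option (List Bool)) : Part (List Bool))

theorem primrec_machineIndex : Primrec machineIndex :=
  Primrec.list_findIdx Primrec.id (Primrec.not.comp Primrec.snd).to₂

theorem primrec_programBody : Primrec programBody :=
  Primrec.list_drop.comp (Primrec.succ.comp primrec_machineIndex) Primrec.id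

theorem partrec_answer : Partrec₂ answer := by
  refine Nat.Partrec.Code.eval_part.comp
    (((Primrec.ofNat Nat.Partrec.Code).comp (primrec_machineIndex.comp Primrec.fst)).to_comp)
    ((Primrec.encode.comp (Primrec.list_take.comp Primrec.snd
      (primrec_programBody.comp Primrec.fst))).to_comp)

theorem partrec_keepsReading : Partrec₂ keepsReading := by
  refine Partrec.nat_rec (f := fun a : List Bool × ℕ => a.2)
    (g := fun _ => Part.some ())
    (h := fun a p => (answer a.1 p.1).bind fun y =>
      ((Nat.casesOn y (some ()) fun _ => none : Option Unit) : Part Unit))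
    Computable.snd (Computable.const ()) ?_
  refine Partrec.bind (partrec_answer.comp (Computable.fst.comp Computable.fst)
    (Computable.fst.comp Computable.snd)) ?_
  exact (Computable.nat_casesOn Computable.snd (Computable.const (some ()))
    (Computable.const none).to₂).ofOption

theorem partrec_universalMachine : Partrec universalMachine := by
  refine Partrec.bind (Primrec.list_head?.comp (Primrec.list_drop.comp primrec_machineIndex
    Primrec.id)).to_comp.ofOption ?_
  refine Partrec.bind (partrec_keepsReading.comp Computable.fst
    ((Primrec.list_length.comp primrec_programBody).to_comp.comp Computable.fst)) ?_
  refine Partrec.bind (partrec_answer.comp (Computable.fst.comp Computable.fst)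
    ((Primrec.list_length.comp primrec_programBody).to_comp.comp
      (Computable.fst.comp Computable.fst))) ?_
  exact (Computable.nat_casesOn Computable.snd (Computable.const none)
    (Computable.decode.comp Computable.snd).to₂).ofOption

theorem mem_keepsReading (w : List Bool) (i : ℕ) (u : Unit) :
    u ∈ keepsReading w i ↔ ∀ j < i, 0 ∈ answer w j := by
  induction i with
  | zero => simp [keepsReading]
  | succ n ih =>
    have h : keepsReading w (n + 1) = (keepsReading w n).bind fun _ => (answer w n).bind fun y =>
      ((Nat.casesOn y (some ()) fun _ => none : Option Unit) : Part Unit) := rfl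
    rw [h]
    simp only [Part.mem_bind_iff]
    constructor
    · rintro ⟨_, h1, y, hy, h2⟩ j hj
      cases y with
      | succ y => simp at h2
      | zero =>
        rcases Nat.lt_succ_iff_lt_or_eq.1 hj with hj | rfl
        · exact ih.1 h1 j hj
        · exact hy
    · intro H
      exact ⟨(), ih.2 fun j hj => H j (by omega), 0, H n (by omega), by simp⟩

theorem mem_universalMachine (w x : List Bool) :
    x ∈ universalMachine w ↔ machineIndex w < w.length ∧
      (∀ j < (programBody w).length, 0 ∈ answer w j) ∧
      ∃ n, n + 1 ∈ answer w (programBody w).length ∧ Encodable.decode n = some x := by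
  simp only [universalMachine, Part.mem_bind_iff, mem_keepsReading]
  constructor
  · rintro ⟨b, hb, _, h1, y, hy, h2⟩
    refine ⟨?_, h1, ?_⟩
    · by_contra hlt
      rw [List.drop_eq_nil_of_le (not_lt.1 hlt)] at hb
      simp at hb
    · cases y with
      | zero => simp at h2
      | succ n => exact ⟨n, hy, by simpa using h2⟩
  · rintro ⟨h0, h1, n, hn, h2⟩
    refine ⟨w[machineIndex w], ?_, (), h1, n + 1, hn, by simpa using h2⟩
    simp [List.head?_drop, List.getElem?_eq_getElem h0]

theorem machineIndex_append {p : List Bool} (h : machineIndex p < p.length) (t : List Bool) :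
    machineIndex (p ++ t) = machineIndex p := by
  unfold machineIndex at *
  rw [List.findIdx_append, if_pos h]

theorem programBody_append {p : List Bool} (h : machineIndex p < p.length) (t : List Bool) :
    programBody (p ++ t) = programBody p ++ t := by
  unfold programBody
  rw [machineIndex_append h, List.drop_append_of_le_length h]

theorem universalMachine_prefixFree (p q : List Bool) (hp : (universalMachine p).Dom)
    (hq : (universalMachine q).Dom) (hpq : p <+: q) : p = q := by
  obtain ⟨x, hx⟩ := Part.dom_iff_mem.1 hp
  obtain ⟨y, hy⟩ := Part.dom_iff_mem.1 hq
  obtain ⟨t, rfl⟩ := hpq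
  rw [mem_universalMachine] at hx hy
  obtain ⟨h0, -, n, hn, -⟩ := hx
  obtain ⟨-, h1, -⟩ := hy
  rcases t.eq_nil_or_concat with rfl | ⟨t', b, rfl⟩
  · simp
  · have h2 := h1 (programBody p).length (by rw [programBody_append h0]; simp)
    unfold answer at h2 hn
    rw [programBody_append h0, machineIndex_append h0, List.take_left] at h2
    rw [List.take_length] at hn
    exact absurd (Part.mem_unique h2 hn) (by simp)

theorem machineIndex_address (k : ℕ) (q : List Bool) :
    machineIndex (List.replicate k true ++ false :: q) = k := by
  induction k with
  | zero => simp [machineIndex, List.findIdx_cons]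
  | succ k ih =>
    unfold machineIndex at ih ⊢
    simp [List.replicate_succ, List.findIdx_cons, ih]

theorem programBody_address (k : ℕ) (q : List Bool) :
    programBody (List.replicate k true ++ false :: q) = q := by
  unfold programBody
  rw [machineIndex_address]
  rw [List.append_cons]
  exact List.drop_left' (by simp)

/-- Every prefix-free machine can be run by reading its program bit by bit. -/
theorem exists_selfDelimiting (M : List Bool →. List Bool) (hM : IsPrefixFreeMachine M) :
    ∃ F : List Bool →. Option (List Bool), Partrec F ∧
      (∀ p x, x ∈ M p → some x ∈ F p) ∧
      (∀ p r, (M p).Dom → r <+: p → r ≠ p → none ∈ F r) := by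
  obtain ⟨c, hc⟩ := Nat.Partrec.Code.exists_code.1 hM.partrec
  have hcM : ∀ p y, y ∈ c.eval (Encodable.encode p) ↔ ∃ x ∈ M p, Encodable.encode x = y := by
    intro p y
    rw [hc]
    simp
  let g : List Bool → ℕ → Option (Option (List Bool)) := fun r m =>
    (Encodable.decode m : Option (ℕ × List Bool)).bind fun a =>
      (Nat.Partrec.Code.evaln a.1 c (Encodable.encode (r ++ a.2))).map fun y =>
        List.casesOn a.2 (Encodable.decode y) fun _ _ => none
  have hg : Computable₂ g := by
    refine Computable.option_bind (Computable.decode.comp Computable.snd) ?_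
    refine Computable.option_map ?_ ?_
    · exact (Nat.Partrec.Code.primrec_evaln.comp
        (((Primrec.fst.comp Primrec.snd).pair (Primrec.const c)).pair
          (Primrec.encode.comp (Primrec.list_append.comp (Primrec.fst.comp Primrec.fst)
            (Primrec.snd.comp Primrec.snd))))).to_comp
    · exact (Primrec.list_casesOn (Primrec.snd.comp (Primrec.snd.comp Primrec.fst))
        (Primrec.decode.comp Primrec.snd) (Primrec.const none).to₂).to_comp
  have key : ∀ r m z, g r m = some z → ∃ t x, x ∈ M (r ++ t) ∧
      ((t = [] ∧ z = some x) ∨ (t ≠ [] ∧ z = none)) := by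
    intro r m z h
    simp only [g, Option.bind_eq_some_iff, Option.map_eq_some_iff] at h
    obtain ⟨⟨s, t⟩, -, y, hy, hz⟩ := h
    obtain ⟨x, hx, rfl⟩ := (hcM _ _).1 (Nat.Partrec.Code.evaln_sound hy)
    refine ⟨t, x, hx, ?_⟩
    cases t with
    | nil => left; simpa using hz.symm
    | cons => right; simpa using hz.symm
  have dom : ∀ r t, (M (r ++ t)).Dom → (Nat.rfindOpt (g r)).Dom := by
    intro r t h
    obtain ⟨x, hx⟩ := Part.dom_iff_mem.1 h
    obtain ⟨s, hs⟩ := Nat.Partrec.Code.evaln_complete.1 ((hcM _ _).2 ⟨x, hx, rfl⟩)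
    rw [Nat.rfindOpt_dom]
    refine ⟨Encodable.encode (s, t),
      List.casesOn t (Encodable.decode (Encodable.encode x)) fun _ _ => none, ?_⟩
    simp only [g, Encodable.encodek, Option.bind_some]
    rw [Option.mem_def.1 hs]
    simp
  refine ⟨fun r => Nat.rfindOpt (g r), Partrec.rfindOpt hg, ?_, ?_⟩
  · intro p x hx
    obtain ⟨z, hz⟩ := Part.dom_iff_mem.1 (dom p [] (by
      rw [List.append_nil]; exact Part.dom_iff_mem.2 ⟨x, hx⟩))
    obtain ⟨m, hm⟩ := Nat.rfindOpt_spec hz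
    obtain ⟨t, x', hx', h⟩ := key p m z hm
    have := hM.prefixFree p (p ++ t) (Part.dom_iff_mem.2 ⟨x, hx⟩)
      (Part.dom_iff_mem.2 ⟨x', hx'⟩) (List.prefix_append p t)
    obtain rfl : t = [] := by simpa using this
    rw [List.append_nil] at hx'
    rcases h with ⟨-, rfl⟩ | ⟨h, -⟩
    · rwa [Part.mem_unique hx hx']
    · exact absurd rfl h
  · rintro p r hp ⟨t, rfl⟩ hne
    obtain ⟨z, hz⟩ := Part.dom_iff_mem.1 (dom r t hp)
    obtain ⟨m, hm⟩ := Nat.rfindOpt_spec hz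
    obtain ⟨t', x', hx', h⟩ := key r m z hm
    rcases h with ⟨rfl, -⟩ | ⟨-, rfl⟩
    · rw [List.append_nil] at hx'
      exact absurd (hM.prefixFree r (r ++ t) (Part.dom_iff_mem.2 ⟨x', hx'⟩) hp
        (List.prefix_append r t)) hne
    · exact hz

/-- The reference machine is an optimal prefix-free machine. -/
theorem isOptimalMachine_universalMachine : IsOptimalMachine universalMachine := by
  refine ⟨⟨partrec_universalMachine, universalMachine_prefixFree⟩, fun M hM => ?_⟩
  obtain ⟨F, hF, hF1, hF2⟩ := exists_selfDelimiting M hM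
  obtain ⟨c, hc⟩ := Nat.Partrec.Code.exists_code.1 hF
  have hcF : ∀ p z, z ∈ F p → Encodable.encode z ∈ c.eval (Encodable.encode p) := by
    intro p z hz
    rw [hc]
    simpa using hz
  refine ⟨Encodable.encode c + 1, fun x => ?_⟩
  have hU : ∀ p, x ∈ M p →
      x ∈ universalMachine (List.replicate (Encodable.encode c) true ++ false :: p) := by
    intro p hp
    rw [mem_universalMachine, machineIndex_address, programBody_address]
    refine ⟨by simp, fun j hj => ?_, Encodable.encode x, ?_, Encodable.encodek x⟩
    · unfold answer
      rw [machineIndex_address, programBody_address, Denumerable.ofNat_encode]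
      exact hcF _ _ (hF2 p (p.take j) (Part.dom_iff_mem.2 ⟨x, hp⟩) (List.take_prefix j p)
        (fun h => by have := congrArg List.length h; simp at this; omega))
    · unfold answer
      rw [machineIndex_address, programBody_address, Denumerable.ofNat_encode, List.take_length]
      exact hcF _ _ (hF1 p x hp)
  by_cases hne : ∃ p, x ∈ M p
  · have hne' : Nonempty {p // x ∈ M p} := let ⟨p, hp⟩ := hne; ⟨⟨p, hp⟩⟩
    obtain ⟨⟨p, hp⟩, h⟩ := ENat.exists_eq_iInf (fun i : {p // x ∈ M p} => (i.1.length : ℕ∞))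
    have h' : complexityOf M x = (p.length : ℕ∞) := by
      rw [h]
      exact iInf_subtype' (p := fun p => x ∈ M p) (f := fun p _ => (p.length : ℕ∞))
    rw [h']
    refine (iInf₂_le (f := fun (p : List Bool) (_ : x ∈ universalMachine p) =>
      (p.length : ℕ∞)) _ (hU p hp)).trans ?_
    simp only [List.length_append, List.length_replicate, List.length_cons]
    exact_mod_cast (by omega : Encodable.encode c + (p.length + 1)
      ≤ p.length + (Encodable.encode c + 1))
  · have : complexityOf M x = ⊤ := by
      unfold complexityOf
      simp only [iInf_eq_top]
      exact fun p hp => absurd ⟨p, hp⟩ hne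
    rw [this, top_add]
    exact le_top

/-- The prefix-free Kolmogorov complexity `K`. -/
noncomputable def kolmogorovComplexity (x : List Bool) : ℕ∞ := complexityOf universalMachine x

/-! ## Algorithmically random Rademacher sequences

Points of `{-1, 1}^ω` are coded as bit sequences, `true` standing for `1` and `false` for `-1`. -/

/-- The initial segment of length `n`. -/
def initialSegment (α : ℕ → Bool) (n : ℕ) : List Bool := (List.range n).map α

/-- `α` is Kolmogorov-Chaitin complex: there is `k` with `K(α ↾ n) ≥ n - k` for all `n`. -/
def IsKC (α : ℕ → Bool) : Prop :=
  ∃ k : ℕ, ∀ n : ℕ, (n : ℕ∞) ≤ kolmogorovComplexity (initialSegment α n) + k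

/-- The sign coded by a bit. -/
def bitSign (b : Bool) : ℝ := if b then 1 else -1

/-- `ε` is the sequence of signs given by the bits of some Kolmogorov-Chaitin complex sequence. -/
def IsAlgRandomRademacher (ε : ℕ → ℝ) : Prop :=
  ∃ α : ℕ → Bool, IsKC α ∧ ∀ n, ε n = bitSign (α n)

/-! ## Computable reals and sequences -/

/-- A computable family of rationals: sign, numerator and denominator are given by recursive
functions. -/
def IsComputableRat {ι : Type} [Primcodable ι] (r : ι → ℚ) : Prop :=
  ∃ s a b : ι → ℕ, Computable s ∧ Computable a ∧ Computable b ∧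
    ∀ i, b i ≠ 0 ∧ r i = (-1) ^ s i * ((a i : ℚ) / (b i : ℚ))

/-- A computable real number. -/
def IsComputableReal (x : ℝ) : Prop :=
  ∃ r : ℕ → ℚ, IsComputableRat r ∧ ∀ k, |(r k : ℝ) - x| ≤ 1 / 2 ^ k

/-- A computable sequence of real numbers: `x n` can be approximated to within `2⁻ᵏ`, effectively
in `n` and `k`. -/
def IsComputableSeq (x : ℕ → ℝ) : Prop :=
  ∃ r : ℕ × ℕ → ℚ, IsComputableRat r ∧ ∀ n k, |(r (n, k) : ℝ) - x n| ≤ 1 / 2 ^ k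

/-- A square computable sequence: a computable sequence with `∑ x n ^ 2` convergent, such that
for each `m ≥ 1` one can effectively find `N m` for which the partial sum of the first `N m` terms
is within `1 / m` of the sum. -/
def IsSquareComputable (x : ℕ → ℝ) : Prop :=
  IsComputableSeq x ∧ Summable (fun k => x k ^ 2) ∧
    ∃ N : ℕ → ℕ, Computable N ∧ ∀ m : ℕ, 1 ≤ m →
      |(∑' k, x k ^ 2) - ∑ k ∈ Finset.range (N m), x k ^ 2| < 1 / (m : ℝ)

end AlgRandom

/-!
The products `x k = lam k * u k` form a computable sequence, and since `lam` is bounded, the modulus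
of convergence of `∑ u k ^ 2` gives computable indices `n 0 < n 1 < …` such that the squares of `x`
over the block `[n j, n (j + 1))` add up to at most a multiple of `16⁻ʲ`
(`IsSquareComputable.exists_blocks`). By Kolmogorov's maximal inequality, the proportion of sign
patterns of length `n (j + 1)` for which some partial sum of `± x k` within this block exceeds `2⁻ʲ`
is at most `4⁻ʲ`. After rounding the `x k` to dyadic rationals these patterns form a finite list that
is computable from `j`: they are read off the tree of all signed walks (`crossingStrings`), and the
maximal inequality becomes a count of the flagged nodes of that tree
(`length_crossingStrings_mul_le`).

A pattern `σ` in the `j`-th list is described by `j` in unary followed by the position of `σ` in the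
list, which takes `n (j + 1) - 2 * j` bits. As `j` determines the length of the second part, this
coding is prefix-free, and it saves about `j` bits. A Kolmogorov-Chaitin complex sequence therefore
meets only finitely many of the lists (`IsKC.eventually_notMem`). So, along such a sequence of
signs, the partial sums oscillate by at most a multiple of `2⁻ʲ` on all blocks from some point on,
and the series is Cauchy (`exists_tendsto_of_block_bound`).
-/

namespace AlgRandom

/-! ### A compression criterion for complex sequences -/

/-- The natural number with little-endian binary digits `q`. -/
def bitsValue (q : List Bool) : ℕ := q.foldr (fun b v => 2 * v + b.toNat) 0

theorem primrec_bitsValue : Primrec bitsValue := by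
  refine Primrec.list_foldr Primrec.id (Primrec.const 0) 
    (h := fun _ (p : Bool × ℕ) => 2 * p.2 + p.1.toNat) ?_
  exact Primrec.nat_add.comp
    (Primrec.nat_mul.comp (Primrec.const 2) (Primrec.snd.comp Primrec.snd))
    ((Primrec.dom_finite Bool.toNat).comp (Primrec.fst.comp Primrec.snd))

theorem exists_bitsValue_eq (l m : ℕ) (h : m < 2 ^ l) :
    ∃ q : List Bool, q.length = l ∧ bitsValue q = m := by
  induction l generalizing m with
  | zero => exact ⟨[], rfl, by simp [bitsValue]; omega⟩
  | succ l ih =>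
    obtain ⟨q, hq, hm⟩ := ih (m / 2) (by rw [pow_succ] at h; omega)
    refine ⟨decide (m % 2 = 1) :: q, by simp [hq], ?_⟩
    have h2 : bitsValue (decide (m % 2 = 1) :: q)
        = 2 * bitsValue q + (decide (m % 2 = 1)).toNat := rfl
    rw [h2, hm]
    rcases Nat.mod_two_eq_zero_or_one m with h1 | h1 <;> simp [h1] <;> omega

/-- The machine that reads `1ʲ 0 q`, where `q` has length `n j - 2 j`, and outputs the entry of
`B j` whose position has the binary digits `q`. -/
def listMachine (n : ℕ → ℕ) (B : ℕ → List (List Bool)) (p : List Bool) : Part (List Bool) :=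
  ((if machineIndex p < p.length ∧
      (programBody p).length = n (machineIndex p) - 2 * machineIndex p
    then (B (machineIndex p))[bitsValue (programBody p)]? else none :
      Option (List Bool)) : Part (List Bool))

/-- The unary block determines the length of what follows it, so no program of `listMachine`
extends another. -/
theorem isPrefixFreeMachine_listMachine {n : ℕ → ℕ} {B : ℕ → List (List Bool)}
    (hn : Computable n) (hB : Computable B) : IsPrefixFreeMachine (listMachine n B) where
  partrec := by
    refine Computable.ofOption ?_
    have hi := primrec_machineIndex.to_comp
    have hc : Computable fun p : List Bool => decide (machineIndex p < p.length ∧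
        (programBody p).length = n (machineIndex p) - 2 * machineIndex p) := by
      have h1 : Primrec fun a : List Bool × ℕ => decide (machineIndex a.1 < a.1.length ∧
          (programBody a.1).length = a.2 - 2 * machineIndex a.1) := by
        have hm : Primrec fun a : List Bool × ℕ => machineIndex a.1 :=
          primrec_machineIndex.comp Primrec.fst
        exact ((Primrec.nat_lt.comp hm (Primrec.list_length.comp Primrec.fst)).and
          (Primrec.eq.comp (Primrec.list_length.comp (primrec_programBody.comp Primrec.fst))
            (Primrec.nat_sub.comp Primrec.snd
              (Primrec.nat_mul.comp (Primrec.const 2) hm)))).decide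
      exact h1.to_comp.comp (Computable.id.pair (hn.comp hi))
    refine (Computable.cond hc (Computable.list_getElem?.comp (hB.comp hi)
      (primrec_bitsValue.comp primrec_programBody).to_comp) (Computable.const none)).of_eq ?_
    intro p
    simp only [Bool.cond_decide]
  prefixFree := by
    have key : ∀ p, (listMachine n B p).Dom → machineIndex p < p.length ∧
        (programBody p).length = n (machineIndex p) - 2 * machineIndex p := by
      intro p hp
      by_contra hcon
      simp [listMachine, if_neg hcon] at hp
    rintro p q hp hq ⟨t, rfl⟩
    have h1 := key _ hp
    have h2 := (key _ hq).2
    rw [programBody_append h1.1, machineIndex_append h1.1, List.length_append, h1.2] at h2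
    have : t = [] := List.length_eq_zero_iff.1 (by omega)
    simp [this]

/-- If the computable finite lists `B j` of strings of length `n j` have relative size at most
`4⁻ʲ`, then their members have short descriptions, so that a Kolmogorov-Chaitin complex sequence
eventually avoids them. -/
theorem IsKC.eventually_notMem {α : ℕ → Bool} (hα : IsKC α) {n : ℕ → ℕ}
    {B : ℕ → List (List Bool)} (hn : Computable n) (hB : Computable B)
    (hcard : ∀ j, (B j).length * 4 ^ j ≤ 2 ^ n j) :
    ∃ J, ∀ j, J ≤ j → initialSegment α (n j) ∉ B j := by
  obtain ⟨k, hk⟩ := hα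
  obtain ⟨c, hc⟩ := isOptimalMachine_universalMachine.optimal _
    (isPrefixFreeMachine_listMachine hn hB)
  refine ⟨k + c + 2, fun j hj hmem => ?_⟩
  obtain ⟨m, hm, hget⟩ := List.getElem_of_mem hmem
  have hpow : (4 : ℕ) ^ j = 2 ^ (2 * j) := by rw [pow_mul]; norm_num
  have hle : 2 * j ≤ n j := by
    have h1 : 1 * 4 ^ j ≤ 2 ^ n j := (Nat.mul_le_mul_right _ (by omega)).trans (hcard j)
    rw [one_mul, hpow] at h1
    exact (Nat.pow_le_pow_iff_right (by norm_num)).1 h1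
  have hlt : m < 2 ^ (n j - 2 * j) := by
    have h1 : m * 2 ^ (2 * j) < 2 ^ (n j - 2 * j) * 2 ^ (2 * j) := by
      rw [← pow_add, Nat.sub_add_cancel hle, ← hpow]
      exact lt_of_lt_of_le (Nat.mul_lt_mul_of_pos_right hm (by positivity)) (hcard j)
    exact lt_of_mul_lt_mul_right h1 (Nat.zero_le _)
  obtain ⟨q, hq, hv⟩ := exists_bitsValue_eq _ m hlt
  have hout : initialSegment α (n j) ∈
      listMachine n B (List.replicate j true ++ false :: q) := by
    unfold listMachine
    rw [machineIndex_address, programBody_address, if_pos ⟨by simp, hq⟩, hv,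
      List.getElem?_eq_getElem hm, hget]
    simp
  have hcompl : complexityOf (listMachine n B) (initialSegment α (n j))
      ≤ ((j + 1 + (n j - 2 * j) : ℕ) : ℕ∞) := by
    refine (iInf₂_le (f := fun (p : List Bool)
      (_ : initialSegment α (n j) ∈ listMachine n B p) => (p.length : ℕ∞)) _ hout).trans ?_
    simp only [List.length_append, List.length_replicate, List.length_cons, hq]
    exact_mod_cast (by omega)
  have h1 : (n j : ℕ∞) ≤ ((j + 1 + (n j - 2 * j) + c + k : ℕ) : ℕ∞) := by
    refine (hk (n j)).trans ?_
    push_cast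
    gcongr
    refine (hc _).trans ?_
    gcongr
    exact_mod_cast hcompl
  have h2 : n j ≤ j + 1 + (n j - 2 * j) + c + k := by exact_mod_cast h1
  omega

/-! ### The tree of signed walks and Kolmogorov's maximal inequality -/

/-- A node of the tree of signed walks: the signs chosen so far, the position `a - b` reached, kept
as a pair `(a, b)` of natural numbers, and whether the walk has crossed the threshold. -/
abbrev WalkNode := List Bool × (ℕ × ℕ) × Bool

/-- The integer `a - b` coded by the pair `(a, b)`. -/
def pairInt (w : ℕ × ℕ) : ℤ := (w.1 : ℤ) - w.2

/-- The integer sign of a bit. -/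
def intSign (b : Bool) : ℤ := bif b then 1 else -1

/-- Add `± pairInt w` to a coded integer, the sign being given by `b`. -/
def pairStep (a w : ℕ × ℕ) (b : Bool) : ℕ × ℕ :=
  bif b then (a.1 + w.1, a.2 + w.2) else (a.1 + w.2, a.2 + w.1)

/-- Whether the coded integer has absolute value at least `t`. -/
def exceeds (t : ℕ) (a : ℕ × ℕ) : Bool := decide (a.2 + t ≤ a.1 ∨ a.1 + t ≤ a.2)

/-- The successor of a node along the sign `b`, the step having length `pairInt w`. -/
def childNode (t : ℕ) (w : ℕ × ℕ) (v : WalkNode) (b : Bool) : WalkNode :=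
  (v.1 ++ [b], pairStep v.2.1 w b, v.2.2 || exceeds t (pairStep v.2.1 w b))

/-- The successors of all nodes of a list. -/
def expandNodes (t : ℕ) (w : ℕ × ℕ) (L : List WalkNode) : List WalkNode :=
  L.flatMap fun v => [childNode t w v true, childNode t w v false]

/-- All nodes of depth `i` in the tree of signed walks with step lengths `w` and threshold `t`. -/
def walkNodes (t : ℕ) (w : ℕ → ℕ × ℕ) : ℕ → List WalkNode
  | 0 => [([], (0, 0), false)]
  | i + 1 => expandNodes t (w i) (walkNodes t w i)

/-- The sign patterns of length `i` whose walk has absolute value at least `t` at some time in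
`1, …, i`. -/
def crossingStrings (t : ℕ) (w : ℕ → ℕ × ℕ) (i : ℕ) : List (List Bool) :=
  (walkNodes t w i).filterMap fun v => bif v.2.2 then some v.1 else none

theorem pairInt_pairStep (a w : ℕ × ℕ) (b : Bool) :
    pairInt (pairStep a w b) = pairInt a + intSign b * pairInt w := by
  cases b <;> simp [pairInt, pairStep, intSign] <;> ring

theorem exceeds_iff (t : ℕ) (a : ℕ × ℕ) : exceeds t a = true ↔ (t : ℤ) ≤ |pairInt a| := by
  simp only [exceeds, decide_eq_true_eq, pairInt, le_abs]
  omega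

/-- The position squared, replaced by the threshold squared once the walk has crossed. -/
def potential (t : ℕ) (v : WalkNode) : ℤ := if v.2.2 then (t : ℤ) ^ 2 else pairInt v.2.1 ^ 2

/-- The averaged potential grows by at most the squared step: an uncrossed walk satisfies the
parallelogram identity, and stopping a walk when it crosses only lowers its potential. -/
theorem potential_childNode_le (t : ℕ) (w : ℕ × ℕ) (v : WalkNode) :
    potential t (childNode t w v true) + potential t (childNode t w v false)
      ≤ 2 * potential t v + 2 * pairInt w ^ 2 := by
  obtain ⟨s, a, f⟩ := v
  cases f with
  | true =>
    simp only [potential, childNode, Bool.true_or, if_true]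
    nlinarith [sq_nonneg (pairInt w)]
  | false =>
    have h : ∀ b, potential t (childNode t w (s, a, false) b)
        ≤ (pairInt a + intSign b * pairInt w) ^ 2 := by
      intro b
      simp only [potential, childNode, Bool.false_or, ← pairInt_pairStep]
      split_ifs with hf
      · rw [exceeds_iff] at hf
        rw [← sq_abs (pairInt _)]
        exact pow_le_pow_left₀ (by positivity) hf 2
      · exact le_rfl
    have h1 := h true
    have h2 := h false
    have h3 : potential t (s, a, false) = pairInt a ^ 2 := by simp [potential]
    simp only [intSign, cond_true, cond_false] at h1 h2
    rw [h3]
    nlinarith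

theorem length_walkNodes (t : ℕ) (w : ℕ → ℕ × ℕ) (i : ℕ) : (walkNodes t w i).length = 2 ^ i := by
  induction i with
  | zero => rfl
  | succ i ih => simp [walkNodes, expandNodes, List.length_flatMap, ih, pow_succ]

theorem sum_potential_le (t : ℕ) (w : ℕ → ℕ × ℕ) (i : ℕ) :
    ((walkNodes t w i).map (potential t)).sum
      ≤ 2 ^ i * ∑ k ∈ Finset.range i, pairInt (w k) ^ 2 := by
  induction i with
  | zero => simp [walkNodes, potential, pairInt]
  | succ i ih =>
    have h : ∀ L : List WalkNode, ((expandNodes t (w i) L).map (potential t)).sum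
        ≤ 2 * (L.map (potential t)).sum + 2 * L.length * pairInt (w i) ^ 2 := by
      intro L
      induction L with
      | nil => simp [expandNodes]
      | cons v L ihL =>
        have := potential_childNode_le t (w i) v
        simp only [expandNodes, List.flatMap_cons, List.map_append, List.sum_append, List.map_cons,
          List.map_nil, List.sum_cons, List.sum_nil, List.length_cons, Nat.cast_add,
          Nat.cast_one] at ihL ⊢
        linarith
    have h1 := h (walkNodes t w i)
    rw [length_walkNodes] at h1
    rw [Finset.sum_range_succ, pow_succ]
    simp only [walkNodes]
    push_cast at h1
    linarith

/-- Kolmogorov's maximal inequality for signed sums, in counting form. -/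
theorem length_crossingStrings_mul_le (t : ℕ) (w : ℕ → ℕ × ℕ) (i : ℕ) :
    ((crossingStrings t w i).length : ℤ) * t ^ 2
      ≤ 2 ^ i * ∑ k ∈ Finset.range i, pairInt (w k) ^ 2 := by
  refine le_trans ?_ (sum_potential_le t w i)
  unfold crossingStrings
  generalize walkNodes t w i = L
  induction L with
  | nil => simp
  | cons v L ih =>
    obtain ⟨s, a, f⟩ := v
    cases f
    · simp only [List.map_cons, List.sum_cons, List.filterMap_cons, cond_false]
      have : 0 ≤ potential t (s, a, false) := by simp [potential]; positivity
      linarith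
    · simp only [List.map_cons, List.sum_cons, List.filterMap_cons, cond_true, List.length_cons]
      have : potential t (s, a, true) = (t : ℤ) ^ 2 := by simp [potential]
      push_cast
      linarith

/-- Every sign sequence is followed by a branch of the tree, and its nodes are flagged once the walk
has crossed the threshold. -/
theorem exists_mem_walkNodes {t : ℕ} (ht : 0 < t) (w : ℕ → ℕ × ℕ) (α : ℕ → Bool) (i : ℕ) :
    ∃ v ∈ walkNodes t w i, v.1 = initialSegment α i ∧
      pairInt v.2.1 = ∑ k ∈ Finset.range i, intSign (α k) * pairInt (w k) ∧
      ∀ m ≤ i, (t : ℤ) ≤ |∑ k ∈ Finset.range m, intSign (α k) * pairInt (w k)| →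
        v.2.2 = true := by
  induction i with
  | zero =>
    refine ⟨([], (0, 0), false), by simp [walkNodes], rfl, by simp [pairInt], fun m hm h => ?_⟩
    obtain rfl : m = 0 := by omega
    simp at h
    omega
  | succ i ih =>
    obtain ⟨v, hv, h1, h2, h3⟩ := ih
    have h4 : pairInt (childNode t (w i) v (α i)).2.1
        = ∑ k ∈ Finset.range (i + 1), intSign (α k) * pairInt (w k) := by
      simp only [childNode]
      rw [pairInt_pairStep, h2, Finset.sum_range_succ]
    refine ⟨childNode t (w i) v (α i), ?_, ?_, h4, ?_⟩
    · simp only [walkNodes, expandNodes, List.mem_flatMap]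
      refine ⟨v, hv, ?_⟩
      cases α i <;> simp
    · simp [childNode, h1, initialSegment, List.range_succ]
    · intro m hm h
      rcases Nat.lt_succ_iff_lt_or_eq.1 (Nat.lt_succ_of_le hm) with hm | rfl
      · simp [childNode, h3 m (by omega) h]
      · rw [← h4, ← exceeds_iff] at h
        simp only [childNode] at h ⊢
        simp [h]

theorem abs_sum_lt_of_notMem_crossingStrings {t : ℕ} (ht : 0 < t) {w : ℕ → ℕ × ℕ}
    {α : ℕ → Bool} {i : ℕ} (h : initialSegment α i ∉ crossingStrings t w i) {m : ℕ} (hm : m ≤ i) :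
    |∑ k ∈ Finset.range m, intSign (α k) * pairInt (w k)| < (t : ℤ) := by
  by_contra! hcon
  obtain ⟨v, hv, h1, -, h3⟩ := exists_mem_walkNodes ht w α i
  refine h (List.mem_filterMap.2 ⟨v, hv, ?_⟩)
  simp [h3 m hm hcon, h1]

theorem primrec_childNode : Primrec fun a : (ℕ × (ℕ × ℕ)) × WalkNode × Bool =>
    childNode a.1.1 a.1.2 a.2.1 a.2.2 := by
  have hstep : Primrec fun a : (ℕ × (ℕ × ℕ)) × WalkNode × Bool =>
      pairStep a.2.1.2.1 a.1.2 a.2.2 := by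
    have ha : Primrec fun a : (ℕ × (ℕ × ℕ)) × WalkNode × Bool => a.2.1.2.1 :=
      Primrec.fst.comp (Primrec.snd.comp (Primrec.fst.comp Primrec.snd))
    have hw : Primrec fun a : (ℕ × (ℕ × ℕ)) × WalkNode × Bool => a.1.2 :=
      Primrec.snd.comp Primrec.fst
    have h1 := Primrec.fst.comp ha
    have h2 := Primrec.snd.comp ha
    have w1 := Primrec.fst.comp hw
    have w2 := Primrec.snd.comp hw
    exact Primrec.cond (Primrec.snd.comp Primrec.snd)
      ((Primrec.nat_add.comp h1 w1).pair (Primrec.nat_add.comp h2 w2))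
      ((Primrec.nat_add.comp h1 w2).pair (Primrec.nat_add.comp h2 w1))
  have hexc : Primrec fun a : ℕ × (ℕ × ℕ) => exceeds a.1 a.2 := by
    have h1 : Primrec fun a : ℕ × (ℕ × ℕ) => a.2.1 := Primrec.fst.comp Primrec.snd
    have h2 : Primrec fun a : ℕ × (ℕ × ℕ) => a.2.2 := Primrec.snd.comp Primrec.snd
    exact ((Primrec.nat_le.comp (Primrec.nat_add.comp h2 Primrec.fst) h1).or
      (Primrec.nat_le.comp (Primrec.nat_add.comp h1 Primrec.fst) h2)).decide
  refine (Primrec.list_concat.comp (Primrec.fst.comp (Primrec.fst.comp Primrec.snd))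
    (Primrec.snd.comp Primrec.snd)).pair (hstep.pair ?_)
  exact Primrec.or.comp (Primrec.snd.comp (Primrec.snd.comp (Primrec.fst.comp Primrec.snd)))
    (hexc.comp ((Primrec.fst.comp Primrec.fst).pair hstep))

theorem primrec_expandNodes : Primrec fun a : (ℕ × (ℕ × ℕ)) × List WalkNode =>
    expandNodes a.1.1 a.1.2 a.2 := by
  refine Primrec.list_flatMap Primrec.snd ?_
  have hb : ∀ b, Primrec fun a : ((ℕ × (ℕ × ℕ)) × List WalkNode) × WalkNode =>
      childNode a.1.1.1 a.1.1.2 a.2 b := fun b =>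
    primrec_childNode.comp
      ((Primrec.fst.comp Primrec.fst).pair (Primrec.snd.pair (Primrec.const b)))
  exact Primrec.list_cons.comp (hb true) (Primrec.list_cons.comp (hb false) (Primrec.const []))

theorem computable_walkNodes {t n : ℕ → ℕ} {w : ℕ → ℕ → ℕ × ℕ} (ht : Computable t)
    (hn : Computable n) (hw : Computable₂ w) :
    Computable fun j => walkNodes (t j) (w j) (n j) := by
  have hstep : Computable₂ fun (j : ℕ) (p : ℕ × List WalkNode) =>
      expandNodes (t j) (w j p.1) p.2 :=
    primrec_expandNodes.to_comp.comp (((ht.comp Computable.fst).pair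
      (hw.comp Computable.fst (Computable.fst.comp Computable.snd))).pair
        (Computable.snd.comp Computable.snd))
  refine (Computable.nat_rec hn (Computable.const [([], (0, 0), false)]) hstep).of_eq ?_
  intro j
  induction n j with
  | zero => rfl
  | succ i ih => simp only [walkNodes, ← ih]

theorem computable_crossingStrings {t n : ℕ → ℕ} {w : ℕ → ℕ → ℕ × ℕ} (ht : Computable t)
    (hn : Computable n) (hw : Computable₂ w) :
    Computable fun j => crossingStrings (t j) (w j) (n j) := by
  have hfilter : Primrec fun L : List WalkNode =>
      L.filterMap fun v => bif v.2.2 then some v.1 else none := by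
    refine Primrec.listFilterMap Primrec.id ?_
    exact Primrec.cond (Primrec.snd.comp (Primrec.snd.comp Primrec.snd))
      (Primrec.option_some.comp (Primrec.fst.comp Primrec.snd)) (Primrec.const none)
  exact hfilter.to_comp.comp (computable_walkNodes ht hn hw)

/-! ### Computable sequences of reals -/

theorem primrec_two_pow : Primrec fun n : ℕ => 2 ^ n :=
  (Primrec₂.unpaired'.1 Nat.Primrec.pow).comp (Primrec.const 2) Primrec.id

theorem IsComputableRat.mul {ι : Type} [Primcodable ι] {r r' : ι → ℚ} (hr : IsComputableRat r)
    (hr' : IsComputableRat r') : IsComputableRat fun i => r i * r' i := by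
  obtain ⟨s, a, b, hs, ha, hb, h⟩ := hr
  obtain ⟨s', a', b', hs', ha', hb', h'⟩ := hr'
  refine ⟨fun i => s i + s' i, fun i => a i * a' i, fun i => b i * b' i,
    Primrec.nat_add.to_comp.comp hs hs', Primrec.nat_mul.to_comp.comp ha ha',
    Primrec.nat_mul.to_comp.comp hb hb', fun i => ⟨mul_ne_zero (h i).1 (h' i).1, ?_⟩⟩
  dsimp only
  rw [(h i).2, (h' i).2, pow_add, Nat.cast_mul, Nat.cast_mul, mul_div_mul_comm]
  ring

theorem IsComputableRat.comp {ι κ : Type} [Primcodable ι] [Primcodable κ] {r : ι → ℚ}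
    (hr : IsComputableRat r) {f : κ → ι} (hf : Computable f) : IsComputableRat fun i => r (f i) := by
  obtain ⟨s, a, b, hs, ha, hb, h⟩ := hr
  exact ⟨_, _, _, hs.comp hf, ha.comp hf, hb.comp hf, fun i => h (f i)⟩

theorem IsComputableSeq.mul {x y : ℕ → ℝ} (hx : IsComputableSeq x) (hy : IsComputableSeq y)
    {C : ℝ} (hxC : ∀ n, |x n| ≤ C) (hyC : ∀ n, |y n| ≤ C) :
    IsComputableSeq fun n => x n * y n := by
  obtain ⟨r, hr, hrx⟩ := hx
  obtain ⟨r', hr', hry⟩ := hy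
  obtain ⟨B, hB⟩ := pow_unbounded_of_one_lt (2 * C + 1) (one_lt_two (α := ℝ))
  have hf : Computable fun i : ℕ × ℕ => (i.1, i.2 + B) :=
    (Primrec.fst.pair (Primrec.nat_add.comp Primrec.snd (Primrec.const B))).to_comp
  refine ⟨_, (hr.comp hf).mul (hr'.comp hf), fun n k => ?_⟩
  have h1 := hrx n (k + B)
  have h2 := hry n (k + B)
  set δ : ℝ := 1 / 2 ^ (k + B) with hδ
  have hδ0 : 0 ≤ δ := by positivity
  have hδ1 : δ ≤ 1 := by
    rw [hδ, div_le_one (by positivity)]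
    exact one_le_pow₀ one_le_two
  have hδk : δ * (2 * C + 1) ≤ 1 / 2 ^ k := by
    rw [hδ, pow_add, one_div_mul_eq_div, div_le_div_iff₀ (by positivity) (by positivity), one_mul,
      mul_comm]
    gcongr
  have hr'1 : |(r' (n, k + B) : ℝ)| ≤ C + 1 := by
    have := abs_sub_abs_le_abs_sub (r' (n, k + B) : ℝ) (y n)
    linarith [hyC n]
  push_cast
  calc |(r (n, k + B) : ℝ) * r' (n, k + B) - x n * y n|
      = |(r (n, k + B) - x n) * r' (n, k + B) + x n * (r' (n, k + B) - y n)| := by ring_nf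
    _ ≤ |(r (n, k + B) : ℝ) - x n| * |(r' (n, k + B) : ℝ)|
        + |x n| * |(r' (n, k + B) : ℝ) - y n| := by
      rw [← abs_mul, ← abs_mul]
      exact abs_add_le _ _
    _ ≤ δ * (C + 1) + C * δ := by
      have hC : 0 ≤ C := (abs_nonneg _).trans (hxC 0)
      gcongr
      exact hxC n
    _ = δ * (2 * C + 1) := by ring
    _ ≤ 1 / 2 ^ k := hδk

/-- A computable sequence of reals has computable dyadic approximations. -/
theorem IsComputableSeq.exists_dyadic {x : ℕ → ℝ} (hx : IsComputableSeq x) :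
    ∃ c : ℕ × ℕ → ℕ × ℕ, Computable c ∧
      ∀ n p, |(pairInt (c (n, p)) : ℝ) / 2 ^ p - x n| ≤ 2 / 2 ^ p := by
  obtain ⟨r, ⟨s, a, b, hs, ha, hb, h⟩, hr⟩ := hx
  have hm : Computable fun i : ℕ × ℕ => a i * 2 ^ i.2 / b i :=
    Primrec.nat_div.to_comp.comp (Primrec.nat_mul.to_comp.comp ha
      (primrec_two_pow.to_comp.comp Computable.snd)) hb
  have hpar : Computable fun i : ℕ × ℕ => (s i).bodd := Computable.nat_bodd.comp hs
  refine ⟨fun i => bif (s i).bodd then (0, a i * 2 ^ i.2 / b i) else (a i * 2 ^ i.2 / b i, 0),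
    Computable.cond hpar ((Computable.const 0).pair hm) (hm.pair (Computable.const 0)),
    fun n p => ?_⟩
  obtain ⟨hb0, hrat⟩ := h (n, p)
  have hr' := hr n p
  set i := (n, p)
  have hbpos : (0 : ℝ) < b i := by exact_mod_cast Nat.pos_of_ne_zero hb0
  set M : ℕ := a i * 2 ^ p / b i with hM
  have hMq : |(M : ℝ) / 2 ^ p - (a i : ℝ) / b i| ≤ 1 / 2 ^ p := by
    have h1 : (M : ℝ) ≤ (a i : ℝ) * 2 ^ p / b i := by
      rw [hM]; exact_mod_cast (Nat.cast_div_le (α := ℝ) (m := a i * 2 ^ p) (n := b i))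
    have h2 : (a i : ℝ) * 2 ^ p / b i < M + 1 := by
      rw [div_lt_iff₀ hbpos]
      have := Nat.lt_mul_div_succ (a i * 2 ^ p) (Nat.pos_of_ne_zero hb0)
      rw [← hM, mul_comm (b i)] at this
      exact_mod_cast this
    have h3 : (M : ℝ) / 2 ^ p - (a i : ℝ) / b i = (M - (a i : ℝ) * 2 ^ p / b i) / 2 ^ p := by
      field_simp
    rw [h3, abs_div, abs_of_pos (by positivity : (0 : ℝ) < 2 ^ p)]
    gcongr
    rw [abs_le]
    constructor <;> linarith
  have hz : |(pairInt (bif (s i).bodd then (0, M) else (M, 0)) : ℝ) / 2 ^ p - (r i : ℝ)|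
      ≤ 1 / 2 ^ p := by
    rw [hrat]
    push_cast
    have hsig : ((-1 : ℝ)) ^ s i = if (s i).bodd then -1 else 1 := by
      rcases Nat.even_or_odd (s i) with he | ho
      · have : (s i).bodd = false := by
          rw [Nat.even_iff, Nat.mod_two_of_bodd] at he
          cases hh : (s i).bodd <;> simp_all
        simp [this, he.neg_one_pow]
      · have : (s i).bodd = true := by
          rw [Nat.odd_iff, Nat.mod_two_of_bodd] at ho
          cases hh : (s i).bodd <;> simp_all
        simp [this, ho.neg_one_pow]
    rw [hsig]
    cases (s i).bodd
    · simpa [pairInt] using hMq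
    · rw [← abs_neg]
      refine le_of_eq_of_le ?_ hMq
      congr 1
      simp [pairInt]
      ring
  calc _ = |((pairInt (bif (s i).bodd then (0, M) else (M, 0)) : ℝ) / 2 ^ p - (r i : ℝ))
        + ((r i : ℝ) - x n)| := by rw [sub_add_sub_cancel]
    _ ≤ 1 / 2 ^ p + 1 / 2 ^ p := (abs_add_le _ _).trans (add_le_add hz hr')
    _ = 2 / 2 ^ p := by ring

/-! ### Convergence along blocks -/

theorem intSign_cast (b : Bool) : (intSign b : ℝ) = bitSign b := by
  cases b <;> simp [intSign, bitSign]

theorem abs_bitSign (b : Bool) : |bitSign b| = 1 := by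
  cases b <;> simp [bitSign]

/-- A sequence whose oscillation over successive blocks decreases geometrically is Cauchy. -/
theorem exists_tendsto_of_block_bound {S : ℕ → ℝ} {n : ℕ → ℕ} (hn : StrictMono n) {J : ℕ} {C : ℝ}
    (h : ∀ j, J ≤ j → ∀ m, n j ≤ m → m ≤ n (j + 1) → |S m - S (n j)| ≤ C / 2 ^ j) :
    ∃ L, Tendsto S atTop (𝓝 L) := by
  have hC : 0 ≤ C := by
    have h0 := (abs_nonneg _).trans (h J le_rfl (n J) le_rfl (hn.monotone (Nat.le_succ J)))
    by_contra! hneg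
    exact absurd h0 (not_le.2 (div_neg_of_neg_of_pos hneg (by positivity)))
  -- Telescoping the geometric bounds over the blocks from `j` on.
  have hend : ∀ j, J ≤ j → ∀ i, |S (n (j + i)) - S (n j)| ≤ 2 * C / 2 ^ j - 2 * C / 2 ^ (j + i) := by
    intro j hj i
    induction i with
    | zero => simp
    | succ i ih =>
      have h1 := h (j + i) (by omega) (n (j + i + 1)) (hn.monotone (Nat.le_succ _)) le_rfl
      have h2 : 2 * C / 2 ^ (j + (i + 1)) = C / 2 ^ (j + i) := by
        rw [← add_assoc, pow_succ]; field_simp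
      have h3 : 2 * C / 2 ^ (j + i) = C / 2 ^ (j + i) + C / 2 ^ (j + i) := by ring
      rw [h2]
      rw [h3] at ih
      have := abs_sub_le (S (n (j + i + 1))) (S (n (j + i))) (S (n j))
      rw [← add_assoc]
      linarith
  have hall : ∀ j, J ≤ j → ∀ m, n j ≤ m → |S m - S (n j)| ≤ 3 * C / 2 ^ j := by
    intro j hj m hm
    obtain ⟨i, hi1, hi2⟩ : ∃ i, n (j + i) ≤ m ∧ m < n (j + i + 1) := by
      have hex : ∃ i, m < n (j + i + 1) := ⟨m, by
        have := hn.le_apply (x := j + m + 1); omega⟩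
      refine ⟨Nat.find hex, ?_, Nat.find_spec hex⟩
      rcases hf : Nat.find hex with _ | i
      · simpa using hm
      · exact not_lt.1 (Nat.find_min hex (m := i) (by omega))
    have h1 := h (j + i) (by omega) m hi1 hi2.le
    have h2 := hend j hj i
    have h3 := abs_sub_le (S m) (S (n (j + i))) (S (n j))
    have h4 : 0 ≤ C / 2 ^ (j + i) := by positivity
    have h5 : C / 2 ^ (j + i) ≤ C / 2 ^ j := by
      gcongr
      · exact one_le_two
      · omega
    have h6 : 2 * C / 2 ^ (j + i) = C / 2 ^ (j + i) + C / 2 ^ (j + i) := by ring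
    have h7 : 3 * C / 2 ^ j = 2 * C / 2 ^ j + C / 2 ^ j := by ring
    linarith
  refine cauchySeq_tendsto_of_complete (Metric.cauchySeq_iff'.2 fun e he => ?_)
  have hlim : Tendsto (fun j : ℕ => 3 * C / 2 ^ j) atTop (𝓝 0) :=
    tendsto_const_nhds.div_atTop (tendsto_pow_atTop_atTop_of_one_lt one_lt_two)
  obtain ⟨j, hj, hlt⟩ := ((eventually_ge_atTop J).and (hlim.eventually_lt_const he)).exists
  exact ⟨n j, fun m hm => lt_of_le_of_lt (by rw [Real.dist_eq]; exact hall j hj m hm) hlt⟩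

/-- An effective Borel-Cantelli argument: if `4⁻ʲ t²` bounds the variance of the `j`-th signed walk,
then the signs of a complex sequence keep all but finitely many of the walks below `t`. -/
theorem IsKC.eventually_abs_sum_lt {α : ℕ → Bool} (hα : IsKC α) {t n : ℕ → ℕ}
    {w : ℕ → ℕ → ℕ × ℕ} (ht : Computable t) (hn : Computable n) (hw : Computable₂ w)
    (htpos : ∀ j, 0 < t j)
    (hvar : ∀ j, (∑ k ∈ Finset.range (n j), pairInt (w j k) ^ 2) * 4 ^ j ≤ (t j : ℤ) ^ 2) :
    ∃ J, ∀ j, J ≤ j → ∀ m ≤ n j,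
      |∑ k ∈ Finset.range m, intSign (α k) * pairInt (w j k)| < (t j : ℤ) := by
  have hcard : ∀ j, (crossingStrings (t j) (w j) (n j)).length * 4 ^ j ≤ 2 ^ n j := by
    intro j
    have hkol := length_crossingStrings_mul_le (t j) (w j) (n j)
    have ht2 : (0 : ℤ) < (t j : ℤ) ^ 2 := by have := htpos j; positivity
    have h : (((crossingStrings (t j) (w j) (n j)).length : ℤ) * 4 ^ j) * (t j : ℤ) ^ 2
        ≤ 2 ^ n j * (t j : ℤ) ^ 2 :=
      calc _ = ((crossingStrings (t j) (w j) (n j)).length : ℤ) * (t j : ℤ) ^ 2 * 4 ^ j := by ring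
        _ ≤ (2 ^ n j * ∑ k ∈ Finset.range (n j), pairInt (w j k) ^ 2) * 4 ^ j := by gcongr
        _ ≤ 2 ^ n j * (t j : ℤ) ^ 2 := by
          rw [mul_assoc]
          gcongr
          exact hvar j
    exact_mod_cast le_of_mul_le_mul_right h ht2
  obtain ⟨J, hJ⟩ := hα.eventually_notMem hn (computable_crossingStrings ht hn hw) hcard
  exact ⟨J, fun j hj m hm => abs_sum_lt_of_notMem_crossingStrings (htpos j) (hJ j hj) hm⟩

/-- A computable sequence whose squares have small sums over a computable sequence of blocks has
convergent signed series along every Kolmogorov-Chaitin complex sequence of signs. -/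
theorem IsKC.exists_tendsto_of_blocks {α : ℕ → Bool} (hα : IsKC α) {x : ℕ → ℝ}
    (hx : IsComputableSeq x) {n : ℕ → ℕ} (hn : Computable n) (hmono : StrictMono n)
    (hsq : ∀ j, ∑ k ∈ Finset.Ico (n j) (n (j + 1)), x k ^ 2 ≤ 1 / (4 * 16 ^ j)) :
    ∃ S : ℝ, Tendsto (fun N => ∑ k ∈ Finset.range N, bitSign (α k) * x k) atTop (𝓝 S) := by
  obtain ⟨c, hc, hcx⟩ := hx.exists_dyadic
  have hn' : Computable fun j => n (j + 1) := hn.comp Computable.succ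
  -- The precision makes the rounding errors of a whole block negligible against `2⁻ʲ`.
  let p : ℕ → ℕ := fun j => n (j + 1) + 2 * j + 3
  let t : ℕ → ℕ := fun j => 2 ^ (n (j + 1) + j + 3)
  let w : ℕ → ℕ → ℕ × ℕ := fun j k => if k < n j then (0, 0) else c (k, p j)
  have hp : Computable p := by
    have : Primrec fun a : ℕ × ℕ => a.2 + 2 * a.1 + 3 :=
      Primrec.nat_add.comp (Primrec.nat_add.comp Primrec.snd
        (Primrec.nat_mul.comp (Primrec.const 2) Primrec.fst)) (Primrec.const 3)
    exact this.to_comp.comp (Computable.id.pair hn')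
  have ht : Computable t := by
    have : Primrec fun a : ℕ × ℕ => a.2 + a.1 + 3 :=
      Primrec.nat_add.comp (Primrec.nat_add.comp Primrec.snd Primrec.fst) (Primrec.const 3)
    exact primrec_two_pow.to_comp.comp (this.to_comp.comp (Computable.id.pair hn'))
  have hw : Computable₂ w := by
    refine (Computable.cond
      (Primrec.nat_lt.decide.to_comp.comp Computable.snd (hn.comp Computable.fst))
      (Computable.const (0, 0))
      (hc.comp (Computable.snd.pair (hp.comp Computable.fst)))).of_eq ?_
    rintro ⟨j, k⟩
    simp only [w, Bool.cond_decide]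
  have hpt : ∀ j, (2 : ℝ) ^ p j = t j * 2 ^ j := by
    intro j
    simp only [p, t, Nat.cast_pow, Nat.cast_ofNat]
    rw [← pow_add]
    congr 1
    ring
  have hpow : ∀ j, (2 : ℝ) ^ n (j + 1) * (8 * 4 ^ j) = 2 ^ p j := by
    intro j
    have : (4 : ℝ) ^ j = 2 ^ (2 * j) := by rw [pow_mul]; norm_num
    rw [this, show (8 : ℝ) = 2 ^ 3 by norm_num, ← pow_add, ← pow_add]
    congr 1
    simp only [p]
    ring
  have hnle : ∀ j, (n (j + 1) : ℝ) ≤ 2 ^ n (j + 1) := fun j => by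
    exact_mod_cast Nat.lt_two_pow_self.le
  -- Sums over an initial segment with the rounded weights are sums over part of the block.
  have hblock : ∀ j m, n j ≤ m → ∀ f : ℕ → ℤ → ℝ, (∀ k, f k 0 = 0) →
      ∑ k ∈ Finset.range m, f k (pairInt (w j k))
        = ∑ k ∈ Finset.Ico (n j) m, f k (pairInt (c (k, p j))) := by
    intro j m hm f hf
    rw [← Finset.sum_range_add_sum_Ico _ hm, Finset.sum_eq_zero, zero_add]
    · refine Finset.sum_congr rfl fun k hk => ?_
      have := (Finset.mem_Ico.1 hk).1
      simp only [w, if_neg (not_lt.2 this)]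
    · intro k hk
      simp only [w, if_pos (Finset.mem_range.1 hk)]
      simp [pairInt, hf]
  have hvar : ∀ j, (∑ k ∈ Finset.range (n (j + 1)), pairInt (w j k) ^ 2) * 4 ^ j
      ≤ (t j : ℤ) ^ 2 := by
    intro j
    have hvar : (∑ k ∈ Finset.range (n (j + 1)), (pairInt (w j k) : ℝ) ^ 2)
        ≤ (2 ^ p j) ^ 2 / 16 ^ j := by
      rw [hblock j _ (hmono.monotone (Nat.le_succ j)) (fun _ z => (z : ℝ) ^ 2) (by simp)]
      have hterm : ∀ k, (pairInt (c (k, p j)) : ℝ) ^ 2 ≤ (2 ^ p j) ^ 2 * (2 * x k ^ 2) + 8 := by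
        intro k
        have h1 := hcx k (p j)
        have hpos : (0 : ℝ) < 2 ^ p j := by positivity
        have h2 : |(pairInt (c (k, p j)) : ℝ) - 2 ^ p j * x k| ≤ 2 := by
          have : (pairInt (c (k, p j)) : ℝ) - 2 ^ p j * x k
              = 2 ^ p j * ((pairInt (c (k, p j)) : ℝ) / 2 ^ p j - x k) := by
            field_simp
          rw [this, abs_mul, abs_of_pos hpos]
          calc _ ≤ (2 : ℝ) ^ p j * (2 / 2 ^ p j) := by gcongr
            _ = 2 := by field_simp
        have h3 := abs_le.1 h2
        nlinarith [sq_nonneg ((pairInt (c (k, p j)) : ℝ) - 2 * (2 ^ p j * x k))]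
      have h8 : (8 : ℝ) * n (j + 1) ≤ (2 ^ p j) ^ 2 / (2 * 16 ^ j) := by
        have h16 : (16 : ℝ) ^ j = 4 ^ j * 4 ^ j := by rw [← mul_pow]; norm_num
        have h1 : (1 : ℝ) ≤ 2 ^ n (j + 1) := one_le_pow₀ one_le_two
        have h2 : ((2 : ℝ) ^ p j) ^ 2 / (2 * 16 ^ j) = 32 * (2 ^ n (j + 1)) ^ 2 := by
          rw [← hpow, h16]
          field_simp
          norm_num
        rw [h2]
        nlinarith [hnle j]
      calc ∑ k ∈ Finset.Ico (n j) (n (j + 1)), (pairInt (c (k, p j)) : ℝ) ^ 2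
          ≤ ∑ k ∈ Finset.Ico (n j) (n (j + 1)), ((2 ^ p j) ^ 2 * (2 * x k ^ 2) + 8) :=
            Finset.sum_le_sum fun k _ => hterm k
        _ = (2 ^ p j) ^ 2 * (2 * ∑ k ∈ Finset.Ico (n j) (n (j + 1)), x k ^ 2)
            + 8 * ((n (j + 1) - n j : ℕ) : ℝ) := by
          rw [Finset.sum_add_distrib, ← Finset.mul_sum, ← Finset.mul_sum]
          simp
          ring
        _ ≤ (2 ^ p j) ^ 2 * (2 * (1 / (4 * 16 ^ j))) + 8 * (n (j + 1) : ℝ) := by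
          gcongr
          · exact hsq j
          · omega
        _ ≤ (2 ^ p j) ^ 2 * (2 * (1 / (4 * 16 ^ j))) + (2 ^ p j) ^ 2 / (2 * 16 ^ j) := by
          gcongr
        _ = (2 ^ p j) ^ 2 / 16 ^ j := by ring
    have h16 : (16 : ℝ) ^ j = 4 ^ j * 4 ^ j := by rw [← mul_pow]; norm_num
    have h4 : ((2 : ℝ) ^ j) ^ 2 = 4 ^ j := by rw [← pow_mul, mul_comm, pow_mul]; norm_num
    have hR : (∑ k ∈ Finset.range (n (j + 1)), (pairInt (w j k) : ℝ) ^ 2) * 4 ^ j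
        ≤ (t j : ℝ) ^ 2 := by
      refine (mul_le_mul_of_nonneg_right hvar (by positivity)).trans (le_of_eq ?_)
      rw [hpt, mul_pow, h4, h16]
      field_simp
    exact_mod_cast hR
  have htpos : ∀ j, 0 < t j := fun j => Nat.two_pow_pos _
  obtain ⟨J, hJ⟩ := hα.eventually_abs_sum_lt ht hn' hw htpos hvar
  refine exists_tendsto_of_block_bound hmono (J := J) (C := 2) fun j hj m hm1 hm2 => ?_
  have hlt := hJ j hj m hm2
  have hltR : |∑ k ∈ Finset.Ico (n j) m, bitSign (α k) * (pairInt (c (k, p j)) : ℝ)| < t j := by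
    rw [← hblock j m hm1 (fun k z => bitSign (α k) * (z : ℝ)) (by simp)]
    simp only [← intSign_cast]
    exact_mod_cast hlt
  rw [← Finset.sum_range_add_sum_Ico _ hm1, add_sub_cancel_left]
  have hround : |∑ k ∈ Finset.Ico (n j) m, bitSign (α k) * (pairInt (c (k, p j)) : ℝ) / 2 ^ p j|
      ≤ 1 / 2 ^ j := by
    rw [← Finset.sum_div, abs_div, abs_of_pos (by positivity : (0 : ℝ) < 2 ^ p j), hpt]
    have : (0 : ℝ) < t j := by exact_mod_cast htpos j
    rw [div_le_div_iff₀ (by positivity) (by positivity)]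
    nlinarith [pow_pos (two_pos (α := ℝ)) j]
  have herr : |∑ k ∈ Finset.Ico (n j) m, bitSign (α k) *
      ((pairInt (c (k, p j)) : ℝ) / 2 ^ p j - x k)| ≤ 1 / 2 ^ j := by
    calc _ ≤ ∑ k ∈ Finset.Ico (n j) m, |bitSign (α k) *
          ((pairInt (c (k, p j)) : ℝ) / 2 ^ p j - x k)| := Finset.abs_sum_le_sum_abs _ _
      _ ≤ ∑ k ∈ Finset.Ico (n j) m, (2 : ℝ) / 2 ^ p j := by
        refine Finset.sum_le_sum fun k _ => ?_
        rw [abs_mul, abs_bitSign, one_mul]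
        exact hcx k (p j)
      _ = ((m - n j : ℕ) : ℝ) * (2 / 2 ^ p j) := by simp
      _ ≤ 2 ^ n (j + 1) * (2 / 2 ^ p j) := by
        gcongr
        refine le_trans ?_ (hnle j)
        exact_mod_cast (by omega)
      _ = 1 / (4 * 4 ^ j) := by
        rw [← hpow]
        field_simp
        norm_num
      _ ≤ 1 / 2 ^ j := by
        have h1 : (2 : ℝ) ^ j ≤ 4 ^ j := by gcongr; norm_num
        have h2 : (0 : ℝ) < 4 ^ j := by positivity
        gcongr
        linarith
  have hdiff : ∑ k ∈ Finset.Ico (n j) m, bitSign (α k) * x k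
      = ∑ k ∈ Finset.Ico (n j) m, bitSign (α k) * (pairInt (c (k, p j)) : ℝ) / 2 ^ p j
        - ∑ k ∈ Finset.Ico (n j) m, bitSign (α k) *
          ((pairInt (c (k, p j)) : ℝ) / 2 ^ p j - x k) := by
    rw [← Finset.sum_sub_distrib]
    refine Finset.sum_congr rfl fun k _ => ?_
    ring
  rw [hdiff]
  refine (abs_sub _ _).trans ((add_le_add hround herr).trans (le_of_eq ?_))
  ring

/-- A square computable sequence and a bound on the multipliers yield computable blocks on which
the sums of squares of the products decrease like `16⁻ʲ`. -/
theorem IsSquareComputable.exists_blocks {u lam : ℕ → ℝ} (hu : IsSquareComputable u) {C : ℝ}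
    (hC : ∀ n, |lam n| ≤ C) : ∃ n : ℕ → ℕ, Computable n ∧ StrictMono n ∧
      ∀ j, ∑ k ∈ Finset.Ico (n j) (n (j + 1)), (lam k * u k) ^ 2 ≤ 1 / (4 * 16 ^ j) := by
  obtain ⟨-, hsum, N, hN, hNu⟩ := hu
  obtain ⟨K, hK⟩ := exists_nat_gt (4 * C ^ 2)
  have hK1 : 0 < K := by
    have : (0 : ℝ) < K := lt_of_le_of_lt (by positivity) hK
    exact_mod_cast this
  have hpow : Primrec fun j : ℕ => K * 2 ^ (4 * j) :=
    Primrec.nat_mul.comp (Primrec.const K)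
      (primrec_two_pow.comp (Primrec.nat_mul.comp (Primrec.const 4) Primrec.id))
  -- The factor `K` absorbs the bound on the multipliers, and the `+ 1` makes `n` strictly monotone.
  let n : ℕ → ℕ := fun j => Nat.rec (N (K * 2 ^ (4 * 0)))
    (fun i b => b + 1 + N (K * 2 ^ (4 * (i + 1)))) j
  have hsucc : ∀ j, n (j + 1) = n j + 1 + N (K * 2 ^ (4 * (j + 1))) := fun j => rfl
  have hNn : ∀ j, N (K * 2 ^ (4 * j)) ≤ n j := by
    intro j
    cases j with
    | zero => exact le_rfl
    | succ j => rw [hsucc]; omega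
  have hmono : StrictMono n := strictMono_nat_of_lt_succ fun j => by rw [hsucc]; omega
  refine ⟨n, ?_, hmono, fun j => ?_⟩
  · have h1 : Computable fun a : ℕ × (ℕ × ℕ) => N (K * 2 ^ (4 * (a.2.1 + 1))) :=
      hN.comp (hpow.to_comp.comp (Computable.succ.comp (Computable.fst.comp Computable.snd)))
    exact Computable.nat_rec Computable.id (Computable.const _)
      (h := fun _ (q : ℕ × ℕ) => q.2 + 1 + N (K * 2 ^ (4 * (q.1 + 1))))
      (Primrec.nat_add.to_comp.comp
        (Computable.succ.comp (Computable.snd.comp Computable.snd)) h1)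
  · have h16 : ((K * 2 ^ (4 * j) : ℕ) : ℝ) = K * 16 ^ j := by
      push_cast
      rw [pow_mul]
      norm_num
    have htail := hNu (K * 2 ^ (4 * j)) (Nat.mul_pos hK1 (by positivity))
    rw [h16] at htail
    have hle : ∑ k ∈ Finset.Ico (n j) (n (j + 1)), u k ^ 2 ≤ 1 / (K * 16 ^ j) := by
      have h1 : ∑ k ∈ Finset.range (n (j + 1)), u k ^ 2 ≤ ∑' k, u k ^ 2 :=
        hsum.sum_le_tsum _ fun k _ => sq_nonneg _
      have h2 := Finset.sum_range_add_sum_Ico (fun k => u k ^ 2)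
        (hmono.monotone (Nat.le_succ j))
      have h3 : ∑ k ∈ Finset.range (N (K * 2 ^ (4 * j))), u k ^ 2
          ≤ ∑ k ∈ Finset.range (n j), u k ^ 2 :=
        Finset.sum_le_sum_of_subset_of_nonneg (Finset.range_mono (hNn j))
          fun k _ _ => sq_nonneg _
      have h4 := (abs_lt.1 htail).2
      linarith
    have hKpos : (0 : ℝ) < K := by exact_mod_cast hK1
    calc ∑ k ∈ Finset.Ico (n j) (n (j + 1)), (lam k * u k) ^ 2
        ≤ ∑ k ∈ Finset.Ico (n j) (n (j + 1)), C ^ 2 * u k ^ 2 := by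
          refine Finset.sum_le_sum fun k _ => ?_
          rw [mul_pow, ← sq_abs (lam k)]
          gcongr
          exact hC k
      _ ≤ (K / 4) * (1 / (K * 16 ^ j)) := by
          rw [← Finset.mul_sum]
          gcongr
          linarith
      _ = 1 / (4 * 16 ^ j) := by field_simp

end AlgRandom

theorem mainTheorem9 (u lam ε : ℕ → ℝ)
    (hu : AlgRandom.IsSquareComputable u)
    (hlam : AlgRandom.IsComputableSeq lam)
    (hbdd : BddAbove (Set.range fun n => |lam n|))
    (hsup : AlgRandom.IsComputableReal (⨆ n, |lam n|))
    (hε : AlgRandom.IsAlgRandomRademacher ε) :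
    ∃ S : ℝ, Tendsto (fun N : ℕ => ∑ n ∈ Finset.range N, ε n * lam n * u n) atTop (𝓝 S) := by
  obtain ⟨α, hα, hεα⟩ := hε
  obtain ⟨C, hC⟩ := hbdd
  have hlamC : ∀ n, |lam n| ≤ C := fun n => hC ⟨n, rfl⟩
  have huD : ∀ n, |u n| ≤ √(∑' k, u k ^ 2) := fun n => by
    rw [← Real.sqrt_sq_eq_abs]
    exact Real.sqrt_le_sqrt (hu.2.1.le_tsum n fun k _ => sq_nonneg _)
  have hx := hlam.mul hu.1 (C := max C (√(∑' k, u k ^ 2)))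
    (fun n => (hlamC n).trans (le_max_left _ _)) (fun n => (huD n).trans (le_max_right _ _))
  obtain ⟨n, hn, hmono, hsq⟩ := hu.exists_blocks hlamC
  obtain ⟨S, hS⟩ := hα.exists_tendsto_of_blocks hx hn hmono hsq
  refine ⟨S, hS.congr fun N => Finset.sum_congr rfl fun k _ => ?_⟩
  rw [hεα, mul_assoc]
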